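/- Let $k=\mathbb{C}$ or $\mathbb{R}$, let $S$ be a finite set of states, and let $C_{abc}\in k$, $B^{ab}\in k$ $(a,b,c\in S)$, $R\in k$ be the data of a diagrammatic state sum model: the data are non-degenerate ($R\neq 0$, $B(\cdot,a)=0\Rightarrow a=0$, $C(\cdot,\cdot,a)=0\Rightarrow a=0$) and satisfy $C_{abc}B^{cd}=B^{de}C_{eab}$ (repeated indices are summed). Let $B_{ab}$ be the inverse matrix of $B^{ab}$, equip $V=k^S$ (with basis $e_a$) with the multiplication $e_a\cdot e_b=C_{ab}{}^c e_c$, $C_{ab}{}^c=C_{abd}B^{dc}$, and put $\beta=B^{ab}\,e_a\cdot e_b$. Suppose the model is planar, i.e. its disk partition functions are invariant under the Pachner moves 2-2 and 1-3: $$C_{ab}{}^{f}C_{fcd}=C_{bc}{}^{f}C_{afd},\qquad C_{abc}=R\,C_{af}{}^{e}\,C_{f'b}{}^{d}\,C_{edc}\,B^{ff'} .$$ The model is said to be isomorphic, by a change of basis $\Phi\colon V\to A$ (a $k$-linear isomorphism), to the model of a finite-dimensional algebra $A$ with Frobenius form $\varepsilon\colon A\to k$ if $\Phi$ carries the multiplication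 of $V$ to that of $A$, the element $R\beta$ to $1$, the functional $v\mapsto B^{-1}(v,R\beta)$ to $\varepsilon$, and $B_{ab}=\varepsilon(\Phi e_a\,\Phi e_b)$, $C_{abc}=\varepsilon(\Phi e_a\,\Phi e_b\,\Phi e_c)$. Below, all matrix sizes $n_i$ are positive. **Complex case** ($k=\mathbb{C}$). The model is isomorphic by a change of basis to one with algebra $A=\bigoplus_{i=1}^N \mathbb{M}_{n_i}(\mathbb{C})$ and Frobenius form $$\varepsilon(a)=\sum_{i=1}^N \mathrm{Tr}(x_i a_i)$$ for some fixed invertible element $x=\oplus_i x_i\in A$. Whenever it is isomorphic to a model of this form, $x$ satisfies $R\,\mathrm{Tr}(x_i^{-1})=1$ for all $i=1,\dots,N$. **Real case** ($k=\mathbb{R}$). The model is isomorphic by a change of basis to one with algebra $A=\bigoplus_{i=1}^N \mathbb{M}_{n_i}(D_i)$, where each $D_i$ is $\mathbb{R}$, $\mathbb{C}$ or the quaternions $\mathbb{H}$ regarded as a real algebra, and Frobenius form $$\varepsilon(a)=\sum_{i=1}^N \mathrm{Re}\,\mathrm{Tr}(x_i a_i)$$ for some fixed invertible element $x=\oplus_i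 x_i\in A$. Whenever it is isomorphic to a model of this form, $x$ satisfies, for all $i=1,\dots,N$, $$R^{-1}=\begin{cases}\mathrm{Tr}(x_i^{-1}) & (D_i=\mathbb{R})\\ 2\,\mathrm{Tr}(x_i^{-1}) & (D_i=\mathbb{C})\\ 4\,\mathrm{Re}\,\mathrm{Tr}(x_i^{-1}) & (D_i=\mathbb{H}),\end{cases}$$ where for $D_i=\mathbb{C}$ the equation holds between complex numbers. -/

import Mathlib

/-- The data `(C, B, R)` of a state sum model with finite set of states `S` over the field `k`:
the triangle amplitudes `C a b c`, the edge matrix `B a b` (upper indices) and the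
amplitude `R` of an interior vertex. -/
structure StateSumData (k : Type*) (S : Type*) where
  C : S → S → S → k
  B : Matrix S S k
  R : k

namespace StateSumData

variable {k S : Type*} [Field k] [Fintype S] [DecidableEq S]

/-- The components of the multiplication map: `mulCoeff a b c` is the coefficient of `e_c` in
`e_a * e_b`, that is, the sum over `d` of `C a b d * B d c`. -/
def mulCoeff (M : StateSumData k S) (a b c : S) : k := ∑ d, M.C a b d * M.B d c

/-- The multiplication map on the space `S → k` spanned by the states. -/
def mul (M : StateSumData k S) (u v : S → k) : S → k :=
  fun c => ∑ a, ∑ b, u a * v b * M.mulCoeff a b c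

/-- The trilinear form with components `C a b c`. -/
def trilin (M : StateSumData k S) (u v w : S → k) : k :=
  ∑ a, ∑ b, ∑ c, u a * v b * w c * M.C a b c

/-- The distinguished element: the image of `B` under the multiplication map, that is,
the sum over `a`, `b` of `B a b • (e_a * e_b)`. -/
def beta (M : StateSumData k S) : S → k :=
  fun c => ∑ a, ∑ b, M.B a b * M.mulCoeff a b c

/-- The identity element `R • beta` of the algebra of a planar model. -/
def unit (M : StateSumData k S) : S → k := M.R • M.beta

/-- The bilinear form on `S → k` whose matrix is the inverse matrix of `B`. -/
noncomputable def bilin (M : StateSumData k S) (u v : S → k) : k :=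
  ∑ a, ∑ b, u a * M.B⁻¹ a b * v b

/-- The Frobenius form: pairing with the identity element. -/
noncomputable def frobeniusForm (M : StateSumData k S) (u : S → k) : k :=
  M.bilin u M.unit

/-- Non-degeneracy of the data: `R ≠ 0`, `B(·, a) = 0 → a = 0` and `C(·, ·, a) = 0 → a = 0`. -/
structure Nondegenerate (M : StateSumData k S) : Prop where
  R_ne_zero : M.R ≠ 0
  B_nondeg : ∀ a : S → k, (∀ i, ∑ j, M.B i j * a j = 0) → a = 0
  C_nondeg : ∀ a : S → k, (∀ i j, ∑ l, M.C i j l * a l = 0) → a = 0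

/-- The data of a diagrammatic state sum model: non-degenerate data such that
`C a b c * B c d` (summed over `c`) equals `B d e * C e a b` (summed over `e`). -/
structure IsDiagrammatic (M : StateSumData k S) : Prop where
  nondegenerate : M.Nondegenerate
  cyclic : ∀ a b d, ∑ c, M.C a b c * M.B c d = ∑ e, M.B d e * M.C e a b

/-! Partition functions `R ^ V * |G|` of the triangulated disks in the two Pachner moves. Here `G`
is the dual graph with all boundary legs pointing downwards, labelled from left to right; each
trivalent vertex contributes `C`, each minimum of an interior line contributes `B`, and `V` is the
number of interior vertices of the triangulation. -/

/-- A single triangle with boundary edges `a, b, c`. -/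
def diskOne (M : StateSumData k S) (a b c : S) : k := M.C a b c

/-- The square with boundary edges `a, b, c, d` cut into two triangles by the diagonal that
separates `a, b` from `c, d`. -/
def diskTwo (M : StateSumData k S) (a b c d : S) : k :=
  ∑ e, ∑ f, M.C a b e * M.B e f * M.C f c d

/-- The square with boundary edges `a, b, c, d` cut into two triangles by the diagonal that
separates `b, c` from `d, a`. -/
def diskTwo' (M : StateSumData k S) (a b c d : S) : k :=
  ∑ e, ∑ f, M.C b c e * M.B e f * M.C a f d

/-- The triangle with boundary edges `a, b, c` cut into three triangles meeting at one
interior vertex. -/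
def diskThree (M : StateSumData k S) (a b c : S) : k :=
  M.R * ∑ e, ∑ e', ∑ d, ∑ d', ∑ f, ∑ f',
    M.C a f e * M.C f' b d * M.C e' d' c * (M.B f f' * M.B e e' * M.B d d')

/-- The data determine a planar state sum model: a diagrammatic state sum model that is
invariant under the Pachner moves 2-2 and 1-3. -/
structure IsPlanar (M : StateSumData k S) : Prop where
  diagrammatic : M.IsDiagrammatic
  pachner22 : ∀ a b c d, M.diskTwo a b c d = M.diskTwo' a b c d
  pachner13 : ∀ a b c, M.diskOne a b c = M.diskThree a b c

/-- The change of basis `Φ` identifies the state sum model `M` with the one given by the algebra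
`A` with Frobenius form `ε`: it carries the multiplication map, the identity element, the
Frobenius form, the inverse of `B` and the amplitudes `C` of `M` to the product, the identity, `ε`,
`ε (u * v)` and `ε (u * v * w)`. -/
structure IsRealizedBy (M : StateSumData k S) {A : Type*} [Ring A] [Algebra k A]
    (ε : A → k) (Φ : (S → k) ≃ₗ[k] A) : Prop where
  map_mul : ∀ u v, Φ (M.mul u v) = Φ u * Φ v
  map_unit : Φ M.unit = 1
  frobeniusForm_eq : ∀ u, M.frobeniusForm u = ε (Φ u)
  bilin_eq : ∀ u v, M.bilin u v = ε (Φ u * Φ v)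
  trilin_eq : ∀ u v w, M.trilin u v w = ε (Φ u * Φ v * Φ w)

end StateSumData

/-- The direct sum of the matrix algebras of size `n i` over `ℂ`. -/
abbrev ComplexMatrixSum {N : ℕ} (n : Fin N → ℕ) : Type :=
  (i : Fin N) → Matrix (Fin (n i)) (Fin (n i)) ℂ

/-- The functional sending `a` to the sum of the traces of `x i * a i`. -/
def complexTraceForm {N : ℕ} {n : Fin N → ℕ} (x a : ComplexMatrixSum n) : ℂ :=
  ∑ i, Matrix.trace (x i * a i)

/-- Names for the three real division algebras `ℝ`, `ℂ` and the quaternions. -/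
inductive RealDiv
  | real
  | complex
  | quaternion

namespace RealDiv

/-- The underlying type of the division algebra. -/
def Carrier : RealDiv → Type
  | real => ℝ
  | complex => ℂ
  | quaternion => Quaternion ℝ

noncomputable instance (D : RealDiv) : DivisionRing D.Carrier :=
  match D with
  | real => inferInstanceAs (DivisionRing ℝ)
  | complex => inferInstanceAs (DivisionRing ℂ)
  | quaternion => inferInstanceAs (DivisionRing (Quaternion ℝ))

noncomputable instance (D : RealDiv) : Algebra ℝ D.Carrier :=
  match D with
  | real => inferInstanceAs (Algebra ℝ ℝ)
  | complex => inferInstanceAs (Algebra ℝ ℂ)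
  | quaternion => inferInstanceAs (Algebra ℝ (Quaternion ℝ))

/-- The real part. -/
def re : (D : RealDiv) → D.Carrier → ℝ
  | real => fun (z : ℝ) => z
  | complex => fun (z : ℂ) => z.re
  | quaternion => fun (z : Quaternion ℝ) => z.re

/-- The relation between `R` and the trace `t` of the inverse of a component of `x`:
`R⁻¹ = t`, `R⁻¹ = 2 * t` (in `ℂ`) or `R⁻¹ = 4 * Re t`. -/
def TraceRelation (R : ℝ) : (D : RealDiv) → D.Carrier → Prop
  | real => fun (t : ℝ) => R⁻¹ = t
  | complex => fun (t : ℂ) => ((R⁻¹ : ℝ) : ℂ) = 2 * t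
  | quaternion => fun (t : Quaternion ℝ) => R⁻¹ = 4 * t.re

end RealDiv

/-- The direct sum of the matrix algebras of size `n i` over `D i`, as a real algebra. -/
abbrev RealMatrixSum {N : ℕ} (n : Fin N → ℕ) (D : Fin N → RealDiv) : Type :=
  (i : Fin N) → Matrix (Fin (n i)) (Fin (n i)) (D i).Carrier

/-- The functional sending `a` to the sum of the real parts of the traces of `x i * a i`. -/
noncomputable def realTraceForm {N : ℕ} {n : Fin N → ℕ} {D : Fin N → RealDiv}
    (x a : RealMatrixSum n D) : ℝ :=
  ∑ i, (D i).re (Matrix.trace (x i * a i))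

/-! The data encode a separable Frobenius algebra. Move 2-2 is associativity of the multiplication.
Modulo associativity, move 1-3 says `u * v = u * (R β) * v`, because `β` is the sum of the products
of the dual bases `e_a` and `f_a = ∑ b, B a b • e_b`. Non-degeneracy of `C` cancels the left factor,
so `R β` is a left identity; cyclicity and invertibility of `B` make it a right identity. The
inverse of `B` is then the pairing `ε (u * v)`.

Since `R ∑ e_a f_a = 1`, averaging a linear projection onto a left ideal with these dual bases makes
it `A`-linear, so the algebra is semisimple (`isSemisimpleRing_of_dual_families`). Wedderburn's
theorem, joined over `ℝ` by Frobenius' theorem on division algebras, gives the matrix blocks. A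
dimension count writes `ε` as a trace form, and non-degeneracy makes its element `x` invertible
(`exists_eq_piTraceForm`).

For the trace relation, `∑ e_a f_a` is recomputed with matrix units. Its diagonal entries in block
`i` are `∑ s, q s * Tr (x_i⁻¹) * p s`, for families `q`, `p` in `D_i` dual under the real part
(under the identity over `ℂ`). Comparison with `R⁻¹` gives the factors 1, 2 and 4. -/

section DivisionAlgebra

/-! ### Frobenius' theorem on real division algebras. -/

variable {D : Type*} [DivisionRing D] [Algebra ℝ D]

/-- An element of a finite-dimensional real division algebra has a real translate whose square is
real. -/
theorem exists_sub_algebraMap_mul_self_eq [FiniteDimensional ℝ D] (x : D) :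
    ∃ a c : ℝ, (x - algebraMap ℝ D a) * (x - algebraMap ℝ D a) = algebraMap ℝ D c := by
  have hx : IsIntegral ℝ x := IsIntegral.of_finite ℝ x
  have hdeg : (minpoly ℝ x).natDegree ≤ 2 := (minpoly.irreducible hx).natDegree_le_two
  have h0 := minpoly.aeval ℝ x
  have hm := minpoly.monic hx
  have hpos := minpoly.natDegree_pos hx
  rw [Polynomial.aeval_eq_sum_range] at h0
  have hc := hm.coeff_natDegree
  obtain h | h : (minpoly ℝ x).natDegree = 1 ∨ (minpoly ℝ x).natDegree = 2 := by omega
  · rw [h] at h0 hc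
    simp only [Finset.sum_range_succ, Finset.sum_range_zero, hc, Algebra.smul_def] at h0
    refine ⟨-(minpoly ℝ x).coeff 0, 0, ?_⟩
    have : x - algebraMap ℝ D (-(minpoly ℝ x).coeff 0) = 0 := by
      rw [← h0]; simp; abel
    rw [this, zero_mul, map_zero]
  · rw [h] at h0 hc
    simp only [Finset.sum_range_succ, Finset.sum_range_zero, hc, Algebra.smul_def] at h0
    set b := (minpoly ℝ x).coeff 1
    set c := (minpoly ℝ x).coeff 0
    -- Completing the square in `x ^ 2 + b x + c = 0`.
    refine ⟨-(b / 2), b ^ 2 / 4 - c, ?_⟩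
    have hcomm : x * algebraMap ℝ D (b / 2) = algebraMap ℝ D (b / 2) * x :=
      (Algebra.commutes _ _).symm
    have hb : algebraMap ℝ D b = algebraMap ℝ D (b / 2) + algebraMap ℝ D (b / 2) := by
      rw [← map_add]; congr 1; ring
    have hbc : algebraMap ℝ D (b ^ 2 / 4 - c) =
        algebraMap ℝ D (b / 2) * algebraMap ℝ D (b / 2) - algebraMap ℝ D c := by
      rw [← map_mul, ← map_sub]; congr 1; ring
    rw [hb] at h0
    rw [hbc, map_neg, sub_neg_eq_add, mul_add, add_mul, add_mul, hcomm, eq_sub_iff_add_eq,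
      ← sub_eq_zero, ← h0]
    simp only [map_one, one_mul, pow_zero, pow_one, mul_one, zero_add, pow_two, add_mul]
    abel

/-- Real scalars are central, so `y² = (√c)²` factors and forces `y = ±√c`. -/
theorem mem_range_algebraMap_of_mul_self {y : D} {c : ℝ} (hc : 0 ≤ c)
    (h : y * y = algebraMap ℝ D c) : ∃ r : ℝ, y = algebraMap ℝ D r := by
  have h2 : y * y = algebraMap ℝ D (√c) * algebraMap ℝ D (√c) := by
    rw [← map_mul, Real.mul_self_sqrt hc, h]
  have hcomm : Commute y (algebraMap ℝ D (√c)) := Algebra.commute_algebraMap_right _ _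
  rcases hcomm.mul_self_eq_mul_self_iff.1 h2 with h | h
  · exact ⟨_, h⟩
  · exact ⟨-√c, by rw [h, map_neg]⟩

theorem exists_real_or_imaginary [FiniteDimensional ℝ D] (x : D) :
    (∃ r : ℝ, x = algebraMap ℝ D r) ∨ ∃ a r : ℝ, r ≠ 0 ∧
      (x - algebraMap ℝ D a) * (x - algebraMap ℝ D a) = -(algebraMap ℝ D r * algebraMap ℝ D r) := by
  obtain ⟨a, c, h⟩ := exists_sub_algebraMap_mul_self_eq x
  rcases le_or_gt 0 c with hc | hc
  · obtain ⟨r, hr⟩ := mem_range_algebraMap_of_mul_self hc h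
    exact Or.inl ⟨r + a, by rw [map_add, ← hr]; abel⟩
  · refine Or.inr ⟨a, √(-c), (Real.sqrt_pos.2 (by linarith)).ne', ?_⟩
    rw [h, ← map_mul, Real.mul_self_sqrt (by linarith), map_neg, neg_neg]

/-- The centralizer of a square root of `-1` in a finite-dimensional real division algebra. -/
theorem exists_eq_add_mul_of_commute [FiniteDimensional ℝ D] {i : D} (hi : i * i = -1) {x : D}
    (hx : Commute x i) : ∃ a b : ℝ, x = algebraMap ℝ D a + algebraMap ℝ D b * i := by
  rcases exists_real_or_imaginary x with ⟨r, h⟩ | ⟨a, r, -, h⟩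
  · exact ⟨r, 0, by simp [h]⟩
  · have hr : Commute (algebraMap ℝ D r) i := Algebra.commute_algebraMap_left _ _
    -- The commuting elements `x - a` and `r i` have equal squares, hence agree up to sign.
    have h2 : (x - algebraMap ℝ D a) * (x - algebraMap ℝ D a) =
        (algebraMap ℝ D r * i) * (algebraMap ℝ D r * i) := by
      rw [h, hr.symm.mul_mul_mul_comm, hi, mul_neg_one]
    have hcomm : Commute (x - algebraMap ℝ D a) (algebraMap ℝ D r * i) :=
      (Algebra.commute_algebraMap_right _ _).mul_right
        (hx.sub_left (Algebra.commute_algebraMap_left _ _))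
    rcases hcomm.mul_self_eq_mul_self_iff.1 h2 with h | h
    · exact ⟨a, r, by rw [← h]; abel⟩
    · exact ⟨a, -r, by rw [map_neg, neg_mul, ← h]; abel⟩

theorem exists_mul_self_eq_neg_one [FiniteDimensional ℝ D]
    (h : ¬ ∀ x : D, ∃ r : ℝ, x = algebraMap ℝ D r) : ∃ i : D, i * i = -1 := by
  push Not at h
  obtain ⟨x, hx⟩ := h
  rcases exists_real_or_imaginary x with ⟨r, h⟩ | ⟨a, r, hr, h⟩
  · exact absurd h (hx r)
  · refine ⟨algebraMap ℝ D r⁻¹ * (x - algebraMap ℝ D a), ?_⟩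
    have hc : Commute (x - algebraMap ℝ D a) (algebraMap ℝ D r⁻¹) :=
      Algebra.commute_algebraMap_right _ _
    rw [hc.mul_mul_mul_comm, h, mul_neg, ← map_mul, ← map_mul, ← map_mul]
    rw [show r⁻¹ * r⁻¹ * (r * r) = 1 by field_simp, map_one]

/-- In a finite-dimensional real division algebra a nonzero element anticommuting with a square root
of `-1` has negative square. -/
theorem exists_mul_self_eq_neg_of_anticommute [FiniteDimensional ℝ D] {i j : D} (hi : i * i = -1)
    (hj : j ≠ 0) (hij : j * i = -(i * j)) :
    ∃ r : ℝ, r ≠ 0 ∧ j * j = -(algebraMap ℝ D r * algebraMap ℝ D r) := by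
  have hi0 : i ≠ 0 := by rintro rfl; simp at hi
  have : CharZero D := charZero_of_injective_algebraMap (algebraMap ℝ D).injective
  have hc : Commute (j * j) i := by
    unfold Commute SemiconjBy
    rw [mul_assoc, hij, mul_neg, ← mul_assoc, hij, neg_mul, neg_neg, mul_assoc]
  obtain ⟨a, b, hab⟩ := exists_eq_add_mul_of_commute hi hc
  -- `j * j = a + b i` commutes with `j`, while `j` anticommutes with `i`; this kills the `i` part.
  have hb : b = 0 := by
    have h1 : j * (j * j) = (j * j) * j := (mul_assoc _ _ _).symm
    have ha : j * algebraMap ℝ D a = algebraMap ℝ D a * j := (Algebra.commutes _ _).symm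
    have hb' : j * algebraMap ℝ D b = algebraMap ℝ D b * j := (Algebra.commutes _ _).symm
    rw [hab, mul_add, add_mul, ha, ← mul_assoc, hb', mul_assoc, hij, mul_neg, mul_assoc] at h1
    have h2 := add_left_cancel h1
    rw [neg_eq_self] at h2
    simpa [hi0, hj] using h2
  rw [hb, map_zero, zero_mul, add_zero] at hab
  -- If `0 ≤ a`, then `j` is real and commutes with `i`, which contradicts anticommutation.
  rcases le_or_gt 0 a with h | h
  · obtain ⟨r, hr⟩ := mem_range_algebraMap_of_mul_self h hab
    have h1 : j * i = i * j := by rw [hr]; exact Algebra.commutes _ _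
    rw [h1, self_eq_neg] at hij
    simp [hi0, hj] at hij
  · refine ⟨√(-a), (Real.sqrt_pos.2 (by linarith)).ne', ?_⟩
    rw [hab, ← map_mul, Real.mul_self_sqrt (by linarith), map_neg, neg_neg]

/-- **Frobenius' theorem** on finite-dimensional real division algebras. -/
theorem exists_algEquiv_realDiv_carrier (D : Type*) [DivisionRing D] [Algebra ℝ D]
    [FiniteDimensional ℝ D] : ∃ E : RealDiv, Nonempty (D ≃ₐ[ℝ] E.Carrier) := by
  by_cases hreal : ∀ x : D, ∃ r : ℝ, x = algebraMap ℝ D r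
  · refine ⟨.real, ⟨(?_ : ℝ ≃ₐ[ℝ] D).symm⟩⟩
    exact AlgEquiv.ofBijective (Algebra.ofId ℝ D) ⟨(algebraMap ℝ D).injective,
      fun x ↦ (hreal x).imp fun r hr ↦ hr.symm⟩
  obtain ⟨i, hi⟩ := exists_mul_self_eq_neg_one hreal
  by_cases hcomplex : ∀ x : D, Commute x i
  · refine ⟨.complex, ⟨(?_ : ℂ ≃ₐ[ℝ] D).symm⟩⟩
    refine AlgEquiv.ofBijective (Complex.lift ⟨i, hi⟩) ⟨(Complex.lift ⟨i, hi⟩).toRingHom.injective,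
      fun x ↦ ?_⟩
    obtain ⟨a, b, h⟩ := exists_eq_add_mul_of_commute hi (hcomplex x)
    exact ⟨⟨a, b⟩, by simp [Complex.liftAux_apply, h, Algebra.smul_def]⟩
  push Not at hcomplex
  obtain ⟨d, hd⟩ := hcomplex
  -- Conjugation by `i` is an involution: `x + i x i` anticommutes with `i`, `x - i x i` commutes
  -- with it, and their sum is `2 x`.
  have key (x : D) : (x + i * x * i) * i = -(i * (x + i * x * i)) := by
    have h1 : i * x * i * i = -(i * x) := by rw [mul_assoc, hi, mul_neg_one]
    have h2 : i * (i * x * i) = -(x * i) := by rw [mul_assoc, ← mul_assoc, hi, neg_one_mul]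
    rw [add_mul, mul_add, h1, h2]; abel
  have key' (x : D) : Commute (x - i * x * i) i := by
    have h1 : i * x * i * i = -(i * x) := by rw [mul_assoc, hi, mul_neg_one]
    have h2 : i * (i * x * i) = -(x * i) := by rw [mul_assoc, ← mul_assoc, hi, neg_one_mul]
    unfold Commute SemiconjBy
    rw [sub_mul, mul_sub, h1, h2]; abel
  have hj0 : d + i * d * i ≠ 0 := by
    intro h
    apply hd
    have h3 : i * (d + i * d * i) = 0 := by rw [h, mul_zero]
    have h2 : i * (i * d * i) = -(d * i) := by rw [mul_assoc, ← mul_assoc, hi, neg_one_mul]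
    rw [mul_add, h2, ← sub_eq_add_neg, sub_eq_zero] at h3
    exact h3.symm
  obtain ⟨r, hr, hjj⟩ := exists_mul_self_eq_neg_of_anticommute hi hj0 (key d)
  obtain ⟨j, hjj, hji⟩ : ∃ j : D, j * j = -1 ∧ j * i = -(i * j) := by
    refine ⟨r⁻¹ • (d + i * d * i), ?_, ?_⟩
    · rw [smul_mul_smul_comm, hjj, Algebra.smul_def, mul_neg, ← map_mul, ← map_mul,
        show r⁻¹ * r⁻¹ * (r * r) = 1 by field_simp, map_one]
    · rw [smul_mul_assoc, key, mul_smul_comm, smul_neg]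
  let q : QuaternionAlgebra.Basis D (-1 : ℝ) 0 (-1) :=
    { i := i, j := j, k := i * j
      i_mul_i := by simp [hi]
      j_mul_j := by simp [hjj]
      i_mul_j := rfl
      j_mul_i := by simp [hji] }
  let φ : Quaternion ℝ →ₐ[ℝ] D := q.liftHom
  refine ⟨.quaternion, ⟨(?_ : Quaternion ℝ ≃ₐ[ℝ] D).symm⟩⟩
  refine AlgEquiv.ofBijective φ ⟨φ.toRingHom.injective, fun x ↦ ?_⟩
  obtain ⟨a, b, hab⟩ := exists_eq_add_mul_of_commute hi (key' x)
  -- Right multiplication by `j` moves the anticommuting part into the centralizer of `i`; `j⁻¹ =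
  -- -j` moves it back.
  have hc : Commute ((x + i * x * i) * j) i := by
    unfold Commute SemiconjBy
    rw [mul_assoc, hji, mul_neg, ← mul_assoc, key, neg_mul, neg_neg, mul_assoc]
  obtain ⟨a', b', hab'⟩ := exists_eq_add_mul_of_commute hi hc
  have h2 : x + i * x * i = -(algebraMap ℝ D a' * j + algebraMap ℝ D b' * (i * j)) := by
    rw [← mul_assoc, ← add_mul, ← hab', mul_assoc _ j j, hjj, mul_neg_one, neg_neg]
  refine ⟨⟨a / 2, b / 2, -a' / 2, -b' / 2⟩, ?_⟩
  have h3 : x = (2⁻¹ : ℝ) • ((x - i * x * i) + (x + i * x * i)) := by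
    rw [sub_add_add_cancel, ← two_smul ℝ x, smul_smul]; norm_num
  rw [h3, h2, hab]
  change algebraMap ℝ D (a / 2) + (b / 2) • i + (-a' / 2) • j + (-b' / 2) • (i * j) = _
  simp only [Algebra.algebraMap_eq_smul_one, smul_mul_assoc, one_mul]
  module

end DivisionAlgebra

/-! ### Semisimplicity by averaging. -/

section DualFamilies

variable {k A ι : Type*} [Field k] [Ring A] [Algebra k A] [Fintype ι]

/-- An algebra with a linear form and dual families `e`, `f` such that a multiple of the sum of the
products `e a * f a` is `1` is semisimple. -/
theorem isSemisimpleRing_of_dual_families {ε : A →ₗ[k] k} {e f : ι → A} {R : k}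
    (hε : ∀ v, v = ∑ a, ε (f a * v) • e a) (hε' : ∀ v, v = ∑ a, ε (v * e a) • f a)
    (h : R • ∑ a, e a * f a = 1) : IsSemisimpleRing A := by
  refine { exists_isCompl := fun I ↦ ?_ }
  obtain ⟨π, hπ⟩ := LinearMap.exists_leftInverse_of_injective (I.subtype.restrictScalars k)
    (LinearMap.ker_eq_bot.2 I.subtype_injective)
  have hπ' (v : I) : π v = v := LinearMap.congr_fun hπ v
  -- In tensor form, `∑ e_a ⊗ f_a x = ∑ x e_a ⊗ f_a`: expand `f_a x` in the `f_c`, then resum over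
  -- `a` to `x e_c`. This makes the averaged projection `A`-linear.
  have key (x m : A) :
      (∑ a, e a • π (f a * (x * m))) = ∑ a, x • e a • π (f a * m) := by
    calc ∑ a, e a • π (f a * (x * m))
        = ∑ a, e a • π ((∑ c, ε (f a * x * e c) • f c) * m) := by
          simp_rw [← hε', mul_assoc]
      _ = ∑ a, ∑ c, (ε (f a * (x * e c)) • e a) • π (f c * m) := by
          refine Finset.sum_congr rfl fun a _ ↦ ?_
          rw [Finset.sum_mul, map_sum, Finset.smul_sum]
          refine Finset.sum_congr rfl fun c _ ↦ ?_
          rw [smul_mul_assoc, map_smul, mul_assoc, smul_assoc, smul_comm]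
      _ = ∑ c, (x * e c) • π (f c * m) := by
          rw [Finset.sum_comm]
          simp_rw [← Finset.sum_smul, ← hε]
      _ = _ := by simp_rw [mul_smul]
  let ρ : A →ₗ[A] I :=
    { toFun m := R • ∑ a, e a • π (f a * m)
      map_add' m m' := by simp [mul_add, Finset.sum_add_distrib]
      map_smul' x m := by
        simp only [smul_eq_mul, key, RingHom.id_apply, ← Finset.smul_sum]
        rw [smul_comm] }
  refine ⟨_, LinearMap.isCompl_of_proj (f := ρ) fun v ↦ ?_⟩
  -- `I` is a left ideal, so `π` fixes `f a * v`, and the average collapses to `R ∑ e_a f_a` acting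
  -- on `v`.
  have (a : ι) : π (f a * (v : A)) = f a • v := hπ' (f a • v)
  change R • ∑ a, e a • π (f a * (v : A)) = v
  simp_rw [this, smul_smul, ← Finset.sum_smul]
  rw [← smul_assoc, h, one_smul]

end DualFamilies

/-! ### Trace forms on products of matrix algebras. -/

section TraceForm

variable {k ι : Type*} {m : ι → Type*} {D : ι → Type*} [Field k] [Fintype ι]
  [∀ i, Fintype (m i)] [∀ i, Ring (D i)] [∀ i, Algebra k (D i)]

/-- The linear form on a product of matrix algebras sending `a` to the sum of the values of `τ i`
at the traces of `x i * a i`. -/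
def piTraceForm (τ : ∀ i, D i →ₗ[k] k) (x : ∀ i, Matrix (m i) (m i) (D i)) :
    (∀ i, Matrix (m i) (m i) (D i)) →ₗ[k] k where
  toFun a := ∑ i, τ i (Matrix.trace (x i * a i))
  map_add' a b := by simp [mul_add, Finset.sum_add_distrib]
  map_smul' r a := by simp [Finset.mul_sum]

theorem piTraceForm_apply (τ : ∀ i, D i →ₗ[k] k) (x a : ∀ i, Matrix (m i) (m i) (D i)) :
    piTraceForm τ x a = ∑ i, τ i (Matrix.trace (x i * a i)) := rfl

variable [DecidableEq ι] [∀ i, DecidableEq (m i)]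

theorem piTraceForm_single (τ : ∀ i, D i →ₗ[k] k) (x : ∀ i, Matrix (m i) (m i) (D i)) (i : ι)
    (j l : m i) (d : D i) :
    piTraceForm τ x (Pi.single i (Matrix.single j l d)) = τ i (x i l j * d) := by
  rw [piTraceForm_apply, Finset.sum_eq_single i]
  · rw [Pi.single_eq_same, Matrix.trace_mul_single, op_smul_eq_mul]
  · intro b _ hb
    simp [Pi.single_eq_of_ne hb]
  · simp

variable {T : ι → Type*} [∀ i, Fintype (T i)]

/-- A matrix expressed through values of a trace form. -/
theorem eq_sum_trace_smul_single {κ D T : Type*} [Fintype κ] [DecidableEq κ] [Fintype T] [Ring D]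
    [Algebra k D] {τ : D →ₗ[k] k} {q p : T → D} (h : ∀ d, d = ∑ s, τ (d * q s) • p s)
    (w : Matrix κ κ D) :
    w = ∑ j, ∑ l, ∑ s, τ (w l j * q s) • Matrix.single l j (p s) := by
  conv_lhs => rw [Matrix.matrix_eq_sum_single w, Finset.sum_comm]
  refine Finset.sum_congr rfl fun j _ ↦ Finset.sum_congr rfl fun l _ ↦ ?_
  conv_lhs => rw [h (w l j)]
  ext
  simp [Matrix.single_apply, Matrix.sum_apply]

/-- The components of the sum of the products of dual families for a trace form. -/
theorem sum_mul_apply_of_dual_families {α : Type*} [Fintype α] {τ : ∀ i, D i →ₗ[k] k}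
    {q p : ∀ i, T i → D i} (h : ∀ i d, d = ∑ s, τ i (d * q i s) • p i s)
    (x : (∀ i, Matrix (m i) (m i) (D i))ˣ) {e f : α → ∀ i, Matrix (m i) (m i) (D i)}
    (hef : ∀ v, v = ∑ a, piTraceForm τ x.val (f a * v) • e a) (i : ι) (c : m i) :
    (∑ a, e a * f a) i c c = ∑ s, q i s * Matrix.trace (x⁻¹.val i) * p i s := by
  obtain ⟨y, hy⟩ : ∃ y : Matrix (m i) (m i) (D i), y = x⁻¹.val i := ⟨_, rfl⟩
  have hyx : y * x.val i = 1 := hy ▸ congr_fun x.inv_mul i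
  rw [← hy]
  have hcoef (a : α) (j l : m i) (s : T i) : τ i ((x.val i * f a i) l j * q i s) =
      piTraceForm τ x.val (f a * Pi.single i (Matrix.single j l (q i s))) := by
    rw [piTraceForm_apply, Finset.sum_eq_single i]
    · rw [Pi.mul_apply, Pi.single_eq_same, ← mul_assoc, Matrix.trace_mul_single,
        op_smul_eq_mul]
    · intro b _ hb
      simp [Pi.single_eq_of_ne hb]
    · simp
  -- Write `f a i = y (x_i f a i)` with `y = x_i⁻¹` and expand the bracket in matrix units: the
  -- coefficients are values of the form, so duality can absorb the sum over `a`.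
  have hf (a : α) : f a i = ∑ j, ∑ l, ∑ s,
      piTraceForm τ x.val (f a * Pi.single i (Matrix.single j l (q i s))) •
        (y * Matrix.single l j (p i s)) := by
    simp_rw [← hcoef]
    conv_lhs => rw [← one_mul (f a i), ← hyx, mul_assoc,
      eq_sum_trace_smul_single (h i) (x.val i * f a i)]
    simp_rw [Matrix.mul_sum, Matrix.mul_smul]
  have he (j l : m i) (s : T i) : ∑ a, piTraceForm τ x.val
      (f a * Pi.single i (Matrix.single j l (q i s))) • e a i = Matrix.single j l (q i s) := by
    have := congr_fun (hef (Pi.single i (Matrix.single j l (q i s)))) i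
    rw [Pi.single_eq_same, Finset.sum_apply] at this
    exact this.symm
  have hsum : (∑ a, e a * f a) i = ∑ j, ∑ l, ∑ s,
      Matrix.single j l (q i s) * y * Matrix.single l j (p i s) := by
    calc (∑ a, e a * f a) i = ∑ a, ∑ j, ∑ l, ∑ s,
          (piTraceForm τ x.val (f a * Pi.single i (Matrix.single j l (q i s))) • e a i) *
            (y * Matrix.single l j (p i s)) := by
          rw [Finset.sum_apply]
          refine Finset.sum_congr rfl fun a _ ↦ ?_
          rw [Pi.mul_apply, hf a]
          simp_rw [Matrix.mul_sum, Matrix.mul_smul, Matrix.smul_mul]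
      _ = ∑ j, ∑ l, ∑ s, ∑ a,
          (piTraceForm τ x.val (f a * Pi.single i (Matrix.single j l (q i s))) • e a i) *
            (y * Matrix.single l j (p i s)) := by
          rw [Finset.sum_comm]
          refine Finset.sum_congr rfl fun j _ ↦ ?_
          rw [Finset.sum_comm]
          refine Finset.sum_congr rfl fun l _ ↦ ?_
          rw [Finset.sum_comm]
      _ = _ := by simp_rw [← Matrix.sum_mul, he, mul_assoc]
  -- Only `j = c` survives; the free sum over `l` then produces the trace of `y`.
  have hcc (j l : m i) (s : T i) :
      (Matrix.single j l (q i s) * y * Matrix.single l j (p i s) : Matrix (m i) (m i) (D i)) c c =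
        if j = c then q i s * y l l * p i s else 0 := by
    rw [Matrix.single_mul_mul_single]
    simp [Matrix.single_apply]
  rw [hsum]
  simp only [Matrix.sum_apply, hcc]
  rw [Finset.sum_eq_single c]
  · rw [Finset.sum_comm]
    simp [Matrix.trace, Finset.mul_sum, Finset.sum_mul]
  · intro b _ hb
    simp [hb]
  · simp

/-- Evaluation on scaled matrix units isolates a single entry of `x`. -/
theorem piTraceForm_injective {τ : ∀ i, D i →ₗ[k] k} (h : ∀ i d, (∀ c, τ i (d * c) = 0) → d = 0) :
    Function.Injective (piTraceForm (m := m) τ) := by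
  intro x y hxy
  ext i j l
  rw [← sub_eq_zero]
  refine h i _ fun c ↦ ?_
  have := LinearMap.congr_fun hxy (Pi.single i (Matrix.single l j c))
  rw [piTraceForm_single, piTraceForm_single] at this
  rw [sub_mul, map_sub, this, sub_self]

/-- Every linear form without a left ideal in its kernel is a trace form of an invertible element. -/
theorem exists_eq_piTraceForm {τ : ∀ i, D i →ₗ[k] k} (h : ∀ i d, (∀ c, τ i (d * c) = 0) → d = 0)
    [FiniteDimensional k (∀ i, Matrix (m i) (m i) (D i))]
    (ε : (∀ i, Matrix (m i) (m i) (D i)) →ₗ[k] k)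
    (hε : ∀ y, (∀ a, ε (y * a) = 0) → y = 0) :
    ∃ x : (∀ i, Matrix (m i) (m i) (D i))ˣ, ε = piTraceForm τ x.val := by
  let t : (∀ i, Matrix (m i) (m i) (D i)) →ₗ[k] Module.Dual k (∀ i, Matrix (m i) (m i) (D i)) :=
    { toFun := piTraceForm τ
      map_add' x y := by
        ext a; simp [piTraceForm_apply, add_mul, Finset.sum_add_distrib]
      map_smul' r x := by
        ext a; simp [piTraceForm_apply, Finset.mul_sum] }
  obtain ⟨x, hx⟩ := (LinearMap.injective_iff_surjective_of_finrank_eq_finrank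
    (Subspace.dual_finrank_eq).symm (f := t)).1 (piTraceForm_injective h) ε
  have hx : piTraceForm τ x = ε := hx
  -- `x * y = 0` puts the right ideal of `y` in the kernel of `ε`. Injectivity of multiplication by
  -- `x` then gives a right inverse in finite dimension, and it is two-sided by cancelling `x`.
  have hinj (y) (hy : x * y = 0) : y = 0 := by
    refine hε y fun a ↦ ?_
    have (i : ι) : x i * (y i * a i) = 0 := by
      rw [← mul_assoc]
      exact (congr_fun (congr_arg (· * a) hy) i).trans (by simp)
    rw [← hx, piTraceForm_apply]
    simp [this]
  obtain ⟨z, hz⟩ := LinearMap.surjective_of_injective (f := LinearMap.mulLeft k x)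
    ((injective_iff_map_eq_zero _).2 hinj) 1
  have hz : x * z = 1 := hz
  have hz' : z * x = 1 := by
    rw [← sub_eq_zero]
    refine hinj _ ?_
    rw [mul_sub, ← mul_assoc, hz]; simp
  exact ⟨⟨x, z, hz, hz'⟩, hx.symm⟩

end TraceForm

/-! ### From Pachner moves to a unital associative multiplication. -/

theorem LinearMap.ext_pi_single_one {k S W : Type*} [Field k] [Fintype S] [DecidableEq S]
    [AddCommGroup W] [Module k W] {f g : (S → k) →ₗ[k] W}
    (h : ∀ a, f (Pi.single a 1) = g (Pi.single a 1)) : f = g :=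
  (Pi.basisFun k S).ext fun a ↦ by simpa using h a

namespace StateSumData

variable {k S : Type*} [Field k] [Fintype S] (M : StateSumData k S)

/-- The multiplication of a state sum model as a bilinear map. -/
def mulHom : (S → k) →ₗ[k] (S → k) →ₗ[k] (S → k) :=
  LinearMap.mk₂ k M.mul
    (fun u u' v ↦ by ext; simp [mul, add_mul, Finset.sum_add_distrib])
    (fun r u v ↦ by ext; simp [mul, mul_assoc, Finset.mul_sum])
    (fun u v v' ↦ by ext; simp [mul, mul_add, add_mul, Finset.sum_add_distrib])
    (fun r u v ↦ by ext; simp [mul, mul_assoc, mul_left_comm, Finset.mul_sum])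

theorem mulHom_apply (u v : S → k) : M.mulHom u v = M.mul u v := rfl

theorem mul_eq_sum (u v : S → k) :
    M.mul u v = ∑ a, ∑ b, (u a * v b) • M.mulCoeff a b := by
  ext c; simp [mul]

variable [DecidableEq S]

/-- The bilinear form with matrix `B⁻¹` as a bilinear map. -/
noncomputable def bilinHom : (S → k) →ₗ[k] (S → k) →ₗ[k] k :=
  LinearMap.mk₂ k M.bilin
    (fun u u' v ↦ by simp [bilin, add_mul, Finset.sum_add_distrib])
    (fun r u v ↦ by simp [bilin, mul_assoc, Finset.mul_sum])
    (fun u v v' ↦ by simp [bilin, mul_add, Finset.sum_add_distrib])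
    (fun r u v ↦ by simp [bilin, mul_left_comm, Finset.mul_sum])

theorem bilinHom_apply (u v : S → k) : M.bilinHom u v = M.bilin u v := rfl

theorem bilin_eq_dotProduct (u v : S → k) : M.bilin u v = u ⬝ᵥ M.B⁻¹.mulVec v := by
  simp [bilin, dotProduct, Matrix.mulVec, Finset.mul_sum, mul_assoc]

theorem bilin_eq_vecMul_dotProduct (u v : S → k) : M.bilin u v = M.B⁻¹.vecMul u ⬝ᵥ v := by
  rw [bilin_eq_dotProduct, Matrix.dotProduct_mulVec]

theorem mul_single_single (a b : S) :
    M.mul (Pi.single a 1) (Pi.single b 1) = M.mulCoeff a b := by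
  ext c; simp [mul, Pi.single_apply]

theorem mul_single_right (u : S → k) (b c : S) :
    M.mul u (Pi.single b 1) c = ∑ a, u a * M.mulCoeff a b c := by
  simp [mul, Pi.single_apply]

theorem mul_single_left (u : S → k) (a c : S) :
    M.mul (Pi.single a 1) u c = ∑ b, u b * M.mulCoeff a b c := by
  simp [mul, Pi.single_apply]

/-- The element of `S → k` dual to the basis vector at `a`. -/
def dualVec (a : S) : S → k := M.B a

theorem sum_single_mul_dualVec : ∑ a, M.mul (Pi.single a 1) (M.dualVec a) = M.beta := by
  ext c
  simp [beta, mul_single_left, dualVec]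

variable {M}

theorem Nondegenerate.isUnit_det (h : M.Nondegenerate) : IsUnit M.B.det := by
  rw [← Matrix.isUnit_iff_isUnit_det, ← Matrix.mulVec_injective_iff_isUnit]
  have : Function.Injective M.B.mulVecLin := by
    rw [← LinearMap.ker_eq_bot, LinearMap.ker_eq_bot']
    exact fun a ha ↦ h.B_nondeg a fun i ↦ congr_fun ha i
  exact this

theorem Nondegenerate.bilin_dualVec (h : M.Nondegenerate) (a : S) (v : S → k) :
    M.bilin (M.dualVec a) v = v a := by
  have : M.dualVec a = M.B.vecMul (Pi.single a 1) := by simp [dualVec, Matrix.row]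
  rw [bilin_eq_vecMul_dotProduct, this, Matrix.vecMul_vecMul, Matrix.mul_nonsing_inv _ h.isUnit_det]
  simp

theorem Nondegenerate.sum_bilin_smul_single (h : M.Nondegenerate) (v : S → k) :
    v = ∑ a, M.bilin (M.dualVec a) v • Pi.single a 1 := by
  simp_rw [h.bilin_dualVec]
  ext; simp [Pi.single_apply]

/-- `B` need not be symmetric, so this expansion is separate from the one in basis vectors, with the
arguments of the pairing in the opposite order. -/
theorem Nondegenerate.sum_bilin_smul_dualVec (h : M.Nondegenerate) (v : S → k) :
    v = ∑ a, M.bilin v (Pi.single a 1) • M.dualVec a := by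
  have : v = M.B.vecMul (M.B⁻¹.vecMul v) := by
    rw [Matrix.vecMul_vecMul, Matrix.nonsing_inv_mul _ h.isUnit_det, Matrix.vecMul_one]
  simp only [bilin_eq_vecMul_dotProduct, dotProduct_single_one]
  rw (occs := .pos [1]) [this]
  ext c
  simp [Matrix.vecMul, dotProduct, dualVec]

theorem Nondegenerate.eq_of_bilin (h : M.Nondegenerate) {u v : S → k}
    (huv : ∀ w, M.bilin u w = M.bilin v w) : u = v := by
  rw [h.sum_bilin_smul_dualVec u, h.sum_bilin_smul_dualVec v]
  simp_rw [huv]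

theorem Nondegenerate.bilin_mul_left (h : M.Nondegenerate) (u v w : S → k) :
    M.bilin (M.mul u v) w = M.trilin u v w := by
  have key (a b : S) : M.B⁻¹.vecMul (M.mulCoeff a b) = M.C a b := by
    have := congr_arg (Matrix.vecMul (M.C a b)) (Matrix.mul_nonsing_inv _ h.isUnit_det)
    rw [← Matrix.vecMul_vecMul, Matrix.vecMul_one] at this
    exact this
  rw [← bilinHom_apply, mul_eq_sum]
  simp only [map_sum, map_smul, LinearMap.sum_apply, LinearMap.smul_apply, bilinHom_apply,
    bilin_eq_vecMul_dotProduct, key, trilin, dotProduct, smul_eq_mul, Finset.mul_sum]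
  refine Finset.sum_congr rfl fun a _ ↦ Finset.sum_congr rfl fun b _ ↦
    Finset.sum_congr rfl fun c _ ↦ by ring

/-- Cyclicity lets the product be formed by raising the first index of `C` instead of the last;
`B⁻¹` lowers it again. -/
theorem IsDiagrammatic.bilin_mul_right (h : M.IsDiagrammatic) (u v w : S → k) :
    M.bilin u (M.mul v w) = M.trilin u v w := by
  have key (b c : S) : M.B⁻¹.mulVec (M.mulCoeff b c) = fun a ↦ M.C a b c := by
    have h1 : M.mulCoeff b c = M.B.mulVec (fun a ↦ M.C a b c) :=
      funext fun d ↦ h.cyclic b c d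
    rw [h1, Matrix.mulVec_mulVec, Matrix.nonsing_inv_mul _ h.nondegenerate.isUnit_det,
      Matrix.one_mulVec]
  rw [← bilinHom_apply, mul_eq_sum]
  simp only [map_sum, map_smul, bilinHom_apply,
    bilin_eq_dotProduct, key, trilin, dotProduct, smul_eq_mul, Finset.mul_sum]
  rw [Finset.sum_congr rfl fun b _ ↦ Finset.sum_comm, Finset.sum_comm]
  refine Finset.sum_congr rfl fun a _ ↦ Finset.sum_congr rfl fun b _ ↦
    Finset.sum_congr rfl fun c _ ↦ by ring

/-- The Pachner move 2-2 makes the multiplication associative. -/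
theorem IsPlanar.mul_assoc (h : M.IsPlanar) (u v w : S → k) :
    M.mul (M.mul u v) w = M.mul u (M.mul v w) := by
  have hC (a b c d : S) : ∑ f, M.mulCoeff a b f * M.C f c d = ∑ f, M.mulCoeff b c f * M.C a f d := by
    have := h.pachner22 a b c d
    simp only [diskTwo, diskTwo'] at this
    rw [Finset.sum_comm] at this
    rw [Finset.sum_comm (f := fun e f ↦ M.C b c e * M.B e f * M.C a f d)] at this
    simpa only [mulCoeff, Finset.sum_mul] using this
  have hm (a b c d : S) :
      ∑ f, M.mulCoeff a b f * M.mulCoeff f c d = ∑ f, M.mulCoeff b c f * M.mulCoeff a f d := by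
    conv_lhs => simp only [mulCoeff.eq_1 M _ c]
    conv_rhs => simp only [mulCoeff.eq_1 M a]
    simp only [Finset.mul_sum, ← _root_.mul_assoc]
    rw [Finset.sum_comm, Finset.sum_comm (f := fun f g ↦ M.mulCoeff b c f * M.C a f g * M.B g d)]
    simp only [← Finset.sum_mul, hC]
  refine LinearMap.congr_fun (f := M.mulHom (M.mulHom u v))
    (g := M.mulHom u ∘ₗ M.mulHom v) (LinearMap.ext_pi_single_one fun c ↦ ?_) w
  refine LinearMap.congr_fun (f := M.mulHom.flip (Pi.single c 1) ∘ₗ M.mulHom u)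
    (g := M.mulHom u ∘ₗ M.mulHom.flip (Pi.single c 1)) (LinearMap.ext_pi_single_one fun b ↦ ?_) v
  refine LinearMap.congr_fun
    (f := M.mulHom.flip (Pi.single c 1) ∘ₗ M.mulHom.flip (Pi.single b 1))
    (g := M.mulHom.flip (M.mul (Pi.single b 1) (Pi.single c 1)))
    (LinearMap.ext_pi_single_one fun a ↦ ?_) u
  ext d
  simp [mulHom_apply, mul_single_single, mul_single_right, mul_single_left, hm]

/-- The Pachner move 1-3 in terms of the multiplication. -/
theorem IsPlanar.mul_eq (h : M.IsPlanar) (u v : S → k) :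
    M.mul u v = M.R • ∑ a, M.mul (M.mul u (Pi.single a 1)) (M.mul (M.dualVec a) v) := by
  have hcomm (F : S → S → S → S → S → S → k) :
      ∑ e, ∑ e', ∑ d, ∑ d', ∑ f, ∑ f', F e e' d d' f f' =
        ∑ f, ∑ e', ∑ d', ∑ f', ∑ d, ∑ e, F e e' d d' f f' := by
    simp only [← Fintype.sum_prod_type']
    exact Fintype.sum_equiv
      ⟨fun x ↦ (x.2.2.2.2.1, x.2.1, x.2.2.2.1, x.2.2.2.2.2, x.2.2.1, x.1),
        fun y ↦ (y.2.2.2.2.2, y.2.1, y.2.2.2.2.1, y.2.2.1, y.1, y.2.2.2.1),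
        fun _ ↦ rfl, fun _ ↦ rfl⟩ _ _ fun _ ↦ rfl
  have hC (a b c : S) : M.C a b c = M.R * ∑ f, ∑ e, ∑ d,
      M.mulCoeff a f e * (∑ f', M.B f f' * M.mulCoeff f' b d) * M.C e d c := by
    refine (h.pachner13 a b c).trans ?_
    rw [diskThree, hcomm]
    congr 1
    refine Finset.sum_congr rfl fun f _ ↦ Finset.sum_congr rfl fun e' _ ↦
      Finset.sum_congr rfl fun d' _ ↦ ?_
    simp only [mulCoeff, Finset.sum_mul, Finset.mul_sum]
    refine Finset.sum_congr rfl fun f' _ ↦ Finset.sum_congr rfl fun d _ ↦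
      Finset.sum_congr rfl fun e _ ↦ by ring
  have hm (a b c : S) : M.mulCoeff a b c = M.R * ∑ f, ∑ e, ∑ d,
      M.mulCoeff a f e * (∑ f', M.B f f' * M.mulCoeff f' b d) * M.mulCoeff e d c := by
    -- The opaque `X` keeps its own structure constants folded while the last index of `C` is
    -- raised.
    have key (X : S → S → S → k)
        (hX : ∀ g, M.C a b g = M.R * ∑ f, ∑ e, ∑ d, X f e d * M.C e d g) :
        ∑ g, M.C a b g * M.B g c = M.R * ∑ f, ∑ e, ∑ d, X f e d * M.mulCoeff e d c := by
      simp_rw [hX, mulCoeff, Finset.mul_sum, Finset.sum_mul]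
      rw [Finset.sum_comm]
      refine Finset.sum_congr rfl fun f _ ↦ ?_
      rw [Finset.sum_comm]
      refine Finset.sum_congr rfl fun e _ ↦ ?_
      rw [Finset.sum_comm]
      refine Finset.sum_congr rfl fun d _ ↦ Finset.sum_congr rfl fun g _ ↦ by ring
    exact key _ (hC a b)
  refine LinearMap.congr_fun (f := M.mulHom u)
    (g := M.R • ∑ a, M.mulHom (M.mul u (Pi.single a 1)) ∘ₗ M.mulHom (M.dualVec a))
    (LinearMap.ext_pi_single_one fun b ↦ ?_) v |>.trans (by simp [mulHom_apply])
  refine LinearMap.congr_fun (f := M.mulHom.flip (Pi.single b 1))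
    (g := M.R • ∑ a, M.mulHom.flip (M.mul (M.dualVec a) (Pi.single b 1)) ∘ₗ
      M.mulHom.flip (Pi.single a 1))
    (LinearMap.ext_pi_single_one fun a ↦ ?_) u |>.trans (by simp [mulHom_apply])
  ext c
  simp only [LinearMap.smul_apply, LinearMap.sum_apply, LinearMap.comp_apply, LinearMap.flip_apply,
    mulHom_apply, mul_single_single, Pi.smul_apply, Finset.sum_apply, smul_eq_mul]
  rw [hm]
  congr 1
  refine Finset.sum_congr rfl fun f _ ↦ ?_
  simp only [mul, dualVec, ← mul_single_right]

/-- Reassociating the 1-3 identity brings the dual bases together in the middle, where they sum to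
`β`. -/
theorem IsPlanar.mul_unit_mul (h : M.IsPlanar) (u v : S → k) :
    M.mul (M.mul u M.unit) v = M.mul u v := by
  rw [h.mul_eq u v]
  rw [unit, ← sum_single_mul_dualVec]
  simp only [← mulHom_apply, map_smul, map_sum, LinearMap.smul_apply, LinearMap.sum_apply]
  simp only [mulHom_apply, h.mul_assoc]

/-- The difference is killed by every left multiplication, hence by `C` in its last slot. -/
theorem IsPlanar.unit_mul (h : M.IsPlanar) (v : S → k) : M.mul M.unit v = v := by
  have hd := h.diagrammatic
  have h1 (u : S → k) : M.mul u (M.mul M.unit v - v) = 0 := by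
    rw [← mulHom_apply, map_sub, mulHom_apply, mulHom_apply, ← h.mul_assoc, h.mul_unit_mul,
      sub_self]
  rw [← sub_eq_zero]
  refine hd.nondegenerate.C_nondeg _ fun i j ↦ ?_
  have h2 : M.trilin (Pi.single i 1) (Pi.single j 1) (M.mul M.unit v - v) = 0 := by
    rw [← hd.bilin_mul_right, h1, ← bilinHom_apply, map_zero]
  simpa [trilin, Pi.single_apply, mul_comm] using h2

theorem IsPlanar.mul_unit (h : M.IsPlanar) (v : S → k) : M.mul v M.unit = v := by
  have hd := h.diagrammatic
  refine hd.nondegenerate.eq_of_bilin fun w ↦ ?_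
  rw [← h.unit_mul w, hd.bilin_mul_right, hd.bilin_mul_right, ← hd.nondegenerate.bilin_mul_left,
    ← hd.nondegenerate.bilin_mul_left, h.mul_unit_mul]

/-- Invariance moves `v` across the pairing, onto the identity. -/
theorem IsPlanar.frobeniusForm_mul (h : M.IsPlanar) (u v : S → k) :
    M.frobeniusForm (M.mul u v) = M.bilin u v := by
  have hd := h.diagrammatic
  rw [frobeniusForm, hd.nondegenerate.bilin_mul_left, ← hd.bilin_mul_right, h.mul_unit]

end StateSumData

/-! ### The semisimple Frobenius algebra of a planar model. -/

namespace StateSumData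

variable {k S : Type*} [Field k] [Fintype S] [DecidableEq S] {M : StateSumData k S}

/-- The algebra of a planar state sum model. -/
def IsPlanar.Alg (_ : M.IsPlanar) : Type _ := S → k

namespace IsPlanar

variable (h : M.IsPlanar)

noncomputable instance : AddCommGroup h.Alg := inferInstanceAs (AddCommGroup (S → k))

noncomputable instance : Module k h.Alg := inferInstanceAs (Module k (S → k))

instance : FiniteDimensional k h.Alg := inferInstanceAs (FiniteDimensional k (S → k))

noncomputable instance : Ring h.Alg :=
  { (inferInstance : AddCommGroup h.Alg) with
    mul := M.mul
    one := M.unit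
    mul_assoc := h.mul_assoc
    one_mul := h.unit_mul
    mul_one := h.mul_unit
    left_distrib := fun u v w ↦ map_add (M.mulHom u) v w
    right_distrib := fun u v w ↦ M.mulHom.map_add₂ u v w
    zero_mul := fun u ↦ M.mulHom.map_zero₂ u
    mul_zero := fun u ↦ map_zero (M.mulHom u) }

noncomputable instance : Algebra k h.Alg :=
  Algebra.ofModule (fun r u v ↦ M.mulHom.map_smul₂ r u v) fun r u v ↦ map_smul (M.mulHom u) r v

/-- The vector space underlying the algebra of a planar state sum model. -/
def toAlg : (S → k) ≃ₗ[k] h.Alg := LinearEquiv.refl k (S → k)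

/-- The Frobenius form as a linear form on the algebra of a planar state sum model. -/
noncomputable def form : h.Alg →ₗ[k] k := M.bilinHom.flip M.unit ∘ₗ h.toAlg.symm.toLinearMap

theorem form_mul (u v : S → k) : h.form (h.toAlg u * h.toAlg v) = M.bilin u v :=
  h.frobeniusForm_mul u v

theorem eq_zero_of_form_mul {u : h.Alg} (hu : ∀ v, h.form (u * v) = 0) : u = 0 :=
  h.diagrammatic.nondegenerate.eq_of_bilin (u := u) (v := 0) fun w ↦
    (h.form_mul u w).symm.trans ((hu w).trans (M.bilinHom.map_zero₂ w).symm)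

instance : IsSemisimpleRing h.Alg := by
  have hn := h.diagrammatic.nondegenerate
  refine isSemisimpleRing_of_dual_families (k := k) (ε := h.form) (R := M.R)
    (e := fun a ↦ h.toAlg (Pi.single a 1)) (f := fun a ↦ h.toAlg (M.dualVec a)) ?_ ?_ ?_
  · intro v
    obtain ⟨v, rfl⟩ := h.toAlg.surjective v
    simp_rw [form_mul, ← map_smul, ← map_sum]
    exact congr_arg _ (hn.sum_bilin_smul_single v)
  · intro v
    obtain ⟨v, rfl⟩ := h.toAlg.surjective v
    simp_rw [form_mul, ← map_smul, ← map_sum]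
    exact congr_arg _ (hn.sum_bilin_smul_dualVec v)
  · exact congr_arg (M.R • ·) M.sum_single_mul_dualVec

/-- An algebra isomorphism realizes a planar state sum model. -/
theorem isRealizedBy {A : Type*} [Ring A] [Algebra k A] (φ : h.Alg ≃ₐ[k] A) {ε : A → k}
    (hε : ∀ u, h.form u = ε (φ u)) : M.IsRealizedBy ε (h.toAlg.trans φ.toLinearEquiv) := by
  have hφ (u : S → k) : h.toAlg.trans φ.toLinearEquiv u = φ (h.toAlg u) := rfl
  refine ⟨fun u v ↦ map_mul φ (h.toAlg u) (h.toAlg v), map_one φ, fun u ↦ hε (h.toAlg u),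
    fun u v ↦ ?_, fun u v w ↦ ?_⟩
  · rw [hφ, hφ, ← map_mul, ← hε, form_mul]
  · rw [hφ, hφ, hφ, ← map_mul, ← map_mul, ← hε, ← h.diagrammatic.nondegenerate.bilin_mul_left]
    exact (h.form_mul (M.mul u v) w).symm

/-- A planar state sum model whose algebra is a product of matrix algebras is realized by a trace
form. -/
theorem exists_isRealizedBy_piTraceForm {ι : Type*} {m D : ι → Type*} [Fintype ι] [DecidableEq ι]
    [∀ i, Fintype (m i)] [∀ i, DecidableEq (m i)] [∀ i, Ring (D i)] [∀ i, Algebra k (D i)]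
    {τ : ∀ i, D i →ₗ[k] k} (hτ : ∀ i d, (∀ c, τ i (d * c) = 0) → d = 0)
    (φ : h.Alg ≃ₐ[k] ∀ i, Matrix (m i) (m i) (D i)) :
    ∃ (x : (∀ i, Matrix (m i) (m i) (D i))ˣ) (Φ : (S → k) ≃ₗ[k] ∀ i, Matrix (m i) (m i) (D i)),
      M.IsRealizedBy (piTraceForm τ x.val) Φ := by
  have := Module.Finite.equiv φ.toLinearEquiv
  obtain ⟨x, hx⟩ := exists_eq_piTraceForm hτ (h.form ∘ₗ φ.symm.toLinearMap) fun y hy ↦ by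
    have : φ.symm y = 0 := h.eq_zero_of_form_mul fun v ↦ by
      simpa using hy (φ v)
    simpa using this
  refine ⟨x, _, h.isRealizedBy φ fun u ↦ ?_⟩
  rw [← hx]
  simp

end IsPlanar

/-- The trace relation for a model realized by a trace form. -/
theorem IsRealizedBy.smul_sum_eq_one {ι : Type*} {m D T : ι → Type*} [Fintype ι] [DecidableEq ι]
    [∀ i, Fintype (m i)] [∀ i, DecidableEq (m i)] [∀ i, Ring (D i)] [∀ i, Algebra k (D i)]
    [∀ i, Fintype (T i)] {τ : ∀ i, D i →ₗ[k] k} {q p : ∀ i, T i → D i}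
    (hqp : ∀ i d, d = ∑ s, τ i (d * q i s) • p i s) {x : (∀ i, Matrix (m i) (m i) (D i))ˣ}
    {Φ : (S → k) ≃ₗ[k] ∀ i, Matrix (m i) (m i) (D i)}
    (hΦ : M.IsRealizedBy (piTraceForm τ x.val) Φ) (hM : M.Nondegenerate) (i : ι) [Nonempty (m i)] :
    M.R • ∑ s, q i s * Matrix.trace (x⁻¹.val i) * p i s = 1 := by
  have h1 (v) : v = ∑ a, piTraceForm τ x.val (Φ (M.dualVec a) * v) • Φ (Pi.single a 1) := by
    obtain ⟨v, rfl⟩ := Φ.surjective v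
    simp_rw [← hΦ.bilin_eq, ← map_smul, ← map_sum]
    exact congr_arg _ (hM.sum_bilin_smul_single v)
  -- Positive matrix size supplies a diagonal entry at which to compare with the identity.
  obtain ⟨c⟩ := ‹Nonempty (m i)›
  rw [← sum_mul_apply_of_dual_families hqp x h1 i c]
  have h2 : M.R • ∑ a, Φ (Pi.single a 1) * Φ (M.dualVec a) = 1 := by
    simp_rw [← hΦ.map_mul, ← map_sum, sum_single_mul_dualVec, ← map_smul]
    exact hΦ.map_unit
  have h3 := congr_fun (congr_fun (congr_fun h2 i) c) c
  simpa using h3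

end StateSumData

/-! ### Dual families in the real division algebras. -/

namespace RealDiv

/-- The real part as a linear form. -/
noncomputable def reHom : (D : RealDiv) → D.Carrier →ₗ[ℝ] ℝ
  | real => (LinearMap.id : ℝ →ₗ[ℝ] ℝ)
  | complex => Complex.reLm
  | quaternion => ({ toFun := fun z ↦ z.re, map_add' := fun _ _ ↦ rfl, map_smul' := fun _ _ ↦ rfl } :
      Quaternion ℝ →ₗ[ℝ] ℝ)

theorem reHom_apply (D : RealDiv) (z : D.Carrier) : D.reHom z = D.re z := by
  cases D <;> rfl

open scoped Quaternion in
/-- Families in `D` that are dual with respect to the real part, and the sandwich sums they give. -/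
theorem exists_dual_families (D : RealDiv) : ∃ q p : Fin 4 → D.Carrier,
    (∀ d, d = ∑ s, D.reHom (d * q s) • p s) ∧
      ∀ (R : ℝ) (t : D.Carrier), R • ∑ s, q s * t * p s = 1 → D.TraceRelation R t := by
  cases D
  -- Zero padding gives all three algebras the same index type.
  · refine ⟨(![1, 0, 0, 0] : Fin 4 → ℝ), (![1, 0, 0, 0] : Fin 4 → ℝ), fun (d : ℝ) ↦ ?_,
      fun R (t : ℝ) h ↦ ?_⟩
    · change d = ∑ s : Fin 4, (d * (![1, 0, 0, 0] : Fin 4 → ℝ) s) • (![1, 0, 0, 0] : Fin 4 → ℝ) s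
      simp [Fin.sum_univ_four]
    · change R • ∑ s : Fin 4, (![1, 0, 0, 0] : Fin 4 → ℝ) s * t * (![1, 0, 0, 0] : Fin 4 → ℝ) s = 1
        at h
      change R⁻¹ = t
      simp only [Fin.sum_univ_four, smul_eq_mul] at h
      exact inv_eq_of_mul_eq_one_right (by simpa using h)
  · refine ⟨(![1, Complex.I, 0, 0] : Fin 4 → ℂ), (![1, -Complex.I, 0, 0] : Fin 4 → ℂ),
      fun (d : ℂ) ↦ ?_, fun R (t : ℂ) h ↦ ?_⟩
    · change d = ∑ s : Fin 4, Complex.re (d * (![1, Complex.I, 0, 0] : Fin 4 → ℂ) s) •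
        (![1, -Complex.I, 0, 0] : Fin 4 → ℂ) s
      apply Complex.ext <;> simp [Fin.sum_univ_four]
    · change R • ∑ s : Fin 4, (![1, Complex.I, 0, 0] : Fin 4 → ℂ) s * t *
        (![1, -Complex.I, 0, 0] : Fin 4 → ℂ) s = 1 at h
      change ((R⁻¹ : ℝ) : ℂ) = 2 * t
      rw [Complex.ofReal_inv]
      refine inv_eq_of_mul_eq_one_right ?_
      rw [← h, Complex.real_smul]
      simp only [Fin.sum_univ_four]
      simp only [Matrix.cons_val]
      linear_combination (R * t : ℂ) * Complex.I_mul_I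
  · obtain ⟨i, hi⟩ : ∃ i : Quaternion ℝ, i.re = 0 ∧ i.imI = 1 ∧ i.imJ = 0 ∧ i.imK = 0 :=
      ⟨⟨0, 1, 0, 0⟩, rfl, rfl, rfl, rfl⟩
    obtain ⟨j, hj⟩ : ∃ j : Quaternion ℝ, j.re = 0 ∧ j.imI = 0 ∧ j.imJ = 1 ∧ j.imK = 0 :=
      ⟨⟨0, 0, 1, 0⟩, rfl, rfl, rfl, rfl⟩
    obtain ⟨l, hl⟩ : ∃ l : Quaternion ℝ, l.re = 0 ∧ l.imI = 0 ∧ l.imJ = 0 ∧ l.imK = 1 :=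
      ⟨⟨0, 0, 0, 1⟩, rfl, rfl, rfl, rfl⟩
    refine ⟨(![1, i, j, l] : Fin 4 → Quaternion ℝ), (![1, -i, -j, -l] : Fin 4 → Quaternion ℝ),
      fun (d : Quaternion ℝ) ↦ ?_, fun R (t : Quaternion ℝ) h ↦ ?_⟩
    · change d = ∑ s : Fin 4, (d * (![1, i, j, l] : Fin 4 → Quaternion ℝ) s).re •
        (![1, -i, -j, -l] : Fin 4 → Quaternion ℝ) s
      rw [Fin.sum_univ_four]
      apply Quaternion.ext <;> simp [hi, hj, hl]
    · change R • ∑ s : Fin 4, (![1, i, j, l] : Fin 4 → Quaternion ℝ) s * t *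
        (![1, -i, -j, -l] : Fin 4 → Quaternion ℝ) s = 1 at h
      change R⁻¹ = 4 * t.re
      refine inv_eq_of_mul_eq_one_right ?_
      -- Real parts suffice: `t - i t i - j t j - l t l` has real part `4 * t.re`.
      have h1 : (R • ∑ s : Fin 4, (![1, i, j, l] : Fin 4 → Quaternion ℝ) s * t *
        (![1, -i, -j, -l] : Fin 4 → Quaternion ℝ) s).re = 1 := by rw [h]; rfl
      rw [Fin.sum_univ_four] at h1
      simp [hi, hj, hl] at h1
      linarith

theorem eq_zero_of_reHom_mul (D : RealDiv) {d : D.Carrier} (h : ∀ c, D.reHom (d * c) = 0) :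
    d = 0 := by
  obtain ⟨q, p, hqp, -⟩ := D.exists_dual_families
  rw [hqp d]
  simp [h]

end RealDiv

/-! ### The classification. -/

theorem complexTraceForm_eq {N : ℕ} {n : Fin N → ℕ} (x : ComplexMatrixSum n) :
    complexTraceForm x = piTraceForm (fun _ ↦ (LinearMap.id : ℂ →ₗ[ℂ] ℂ)) x := rfl

theorem realTraceForm_eq {N : ℕ} {n : Fin N → ℕ} {D : Fin N → RealDiv} (x : RealMatrixSum n D) :
    realTraceForm x = piTraceForm (fun i ↦ (D i).reHom) x := by
  ext a
  simp [realTraceForm, piTraceForm_apply, RealDiv.reHom_apply]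

theorem mainTheorem4 {S : Type*} [Fintype S] [DecidableEq S] :
    (∀ M : StateSumData ℂ S, M.IsPlanar →
      (∃ (N : ℕ) (n : Fin N → ℕ) (x : (ComplexMatrixSum n)ˣ)
          (Φ : (S → ℂ) ≃ₗ[ℂ] ComplexMatrixSum n),
        (∀ i, 0 < n i) ∧
          M.IsRealizedBy (complexTraceForm (x : ComplexMatrixSum n)) Φ) ∧
      (∀ (N : ℕ) (n : Fin N → ℕ) (x : (ComplexMatrixSum n)ˣ)
          (Φ : (S → ℂ) ≃ₗ[ℂ] ComplexMatrixSum n),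
        (∀ i, 0 < n i) →
          M.IsRealizedBy (complexTraceForm (x : ComplexMatrixSum n)) Φ →
            ∀ i, M.R * Matrix.trace ((↑x⁻¹ : ComplexMatrixSum n) i) = 1)) ∧
    (∀ M : StateSumData ℝ S, M.IsPlanar →
      (∃ (N : ℕ) (n : Fin N → ℕ) (D : Fin N → RealDiv) (x : (RealMatrixSum n D)ˣ)
          (Φ : (S → ℝ) ≃ₗ[ℝ] RealMatrixSum n D),
        (∀ i, 0 < n i) ∧
          M.IsRealizedBy (realTraceForm (x : RealMatrixSum n D)) Φ) ∧
      (∀ (N : ℕ) (n : Fin N → ℕ) (D : Fin N → RealDiv) (x : (RealMatrixSum n D)ˣ)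
          (Φ : (S → ℝ) ≃ₗ[ℝ] RealMatrixSum n D),
        (∀ i, 0 < n i) →
          M.IsRealizedBy (realTraceForm (x : RealMatrixSum n D)) Φ →
            ∀ i, RealDiv.TraceRelation M.R (D i)
              (Matrix.trace ((↑x⁻¹ : RealMatrixSum n D) i)))) := by
  refine ⟨fun M hM ↦ ⟨?_, fun N n x Φ hn hΦ i ↦ ?_⟩, fun M hM ↦ ⟨?_, fun N n D x Φ hn hΦ i ↦ ?_⟩⟩
  · obtain ⟨N, n, hn, ⟨φ⟩⟩ :=
      IsSemisimpleRing.exists_algEquiv_pi_matrix_of_isAlgClosed ℂ hM.Alg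
    obtain ⟨x, Φ, hΦ⟩ := hM.exists_isRealizedBy_piTraceForm
      (τ := fun _ ↦ (LinearMap.id : ℂ →ₗ[ℂ] ℂ)) (fun _ d hd ↦ by simpa using hd 1) φ
    exact ⟨N, n, x, Φ, fun i ↦ Nat.pos_of_ne_zero (hn i).out, hΦ⟩
  · have : NeZero (n i) := ⟨(hn i).ne'⟩
    rw [complexTraceForm_eq] at hΦ
    -- Over `ℂ` as ground field, the single element `1` is its own dual family.
    simpa using hΦ.smul_sum_eq_one (T := fun _ ↦ Unit) (q := fun _ _ ↦ 1) (p := fun _ _ ↦ 1)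
      (fun _ d ↦ by simp) hM.diagrammatic.nondegenerate i
  · obtain ⟨N, K, n, _, _, _, hn, ⟨φ⟩⟩ :=
      IsSemisimpleRing.exists_algEquiv_pi_matrix_divisionRing_finite ℝ hM.Alg
    choose D hD using fun i ↦ exists_algEquiv_realDiv_carrier (K i)
    let ψ : hM.Alg ≃ₐ[ℝ] RealMatrixSum n D :=
      φ.trans (AlgEquiv.piCongrRight fun i ↦ (hD i).some.mapMatrix)
    obtain ⟨x, Φ, hΦ⟩ := hM.exists_isRealizedBy_piTraceForm
      (τ := fun i ↦ (D i).reHom) (fun i _ hd ↦ (D i).eq_zero_of_reHom_mul hd) ψ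
    exact ⟨N, n, D, x, Φ, fun i ↦ Nat.pos_of_ne_zero (hn i).out, realTraceForm_eq x.val ▸ hΦ⟩
  · have : NeZero (n i) := ⟨(hn i).ne'⟩
    rw [realTraceForm_eq] at hΦ
    choose q p hqp hrel using fun i ↦ (D i).exists_dual_families
    exact hrel i _ _ (hΦ.smul_sum_eq_one hqp hM.diagrammatic.nondegenerate i)
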